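/- Let $\Omega$ be a finite set and $\lambda\in(0,1)$. For probability distributions $P,Q$ on $\Omega$ let $$D_\lambda(P,Q)=\lambda\,\mathrm{KL}(P\,\|\,M_\lambda)+(1-\lambda)\,\mathrm{KL}(Q\,\|\,M_\lambda),\qquad M_\lambda=\lambda P+(1-\lambda)Q,$$ be the generalized Jensen–Shannon divergence with parameter $\lambda$, and let $\sqrt P=(\sqrt{P(i)})_{i\in\Omega}\in\mathbb R^{\Omega}$. Put $\eta(x)=-x\ln x$, $L(\lambda)=2\min\{\eta(\lambda),\eta(1-\lambda)\}$ and $U(\lambda)=\frac{2\lambda(1-\lambda)}{1-2\lambda}\ln\frac{1-\lambda}{\lambda}$, with $U(1/2)=1$ (the limit value). For $r>0$ consider the random hash functions of bucket width $r$, $$h_{\mathbf a,b}(P)=\left\lceil\frac{\mathbf a\cdot\sqrt P+b}{r}\right\rceil,$$ where $\mathbf a\sim\mathcal N(0,I)$ is a standard normal vector in $\mathbb R^{\Omega}$ and $b$ is uniform on $[0,r]$ and independent of $\mathbf a$. For $u>0$ let $$p_r(u)=\int_0^r\frac1u f_2\!\left(\frac tu\right)\left(1-\frac tr\right)dt,$$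 where $f_2$ is the probability density function of the absolute value of a standard normal variable. A random hash function $h$ is called $(r_1,r_2,p_1,p_2)$-sensitive for $D_\lambda$ if $r_1<r_2$, $p_1>p_2$, and for all distributions $P,Q$ on $\Omega$: $D_\lambda(P,Q)\le r_1$ implies $\Pr[h(P)=h(Q)]\ge p_1$, and $D_\lambda(P,Q)>r_2$ implies $\Pr[h(P)=h(Q)]\le p_2$. Theorem. Let $r>0$. (i) For all distributions $P\ne Q$ on $\Omega$, $\Pr[h_{\mathbf a,b}(P)=h_{\mathbf a,b}(Q)]=p_r\big(\|\sqrt P-\sqrt Q\|_2\big)$. (ii) Let $R>0$, $c>1$ and $R_1=\sqrt{2R/L(\lambda)}$. The hash functions $h_{\mathbf a,b}$ of bucket width $r$ form an $$\Big(R,\;c^2\tfrac{U(\lambda)}{L(\lambda)}R,\;p_r(R_1),\;p_r(cR_1)\Big)\text{-sensitive}$$ family for $D_\lambda$. Equivalently, when the bucket width is measured in units of $R_1$, i.e. when the hash functions of bucket width $rR_1$ (with $b$ uniform on $[0,rR_1]$) are used, they form an $$\Big(R,\;c^2\tfrac{U(\lambda)}{L(\lambda)}R,\;p_r(1),\;p_r(c)\Big)\text{-sensitive}$$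 family for $D_\lambda$. (For $R=L(\lambda)/2$ one has $R_1=1$ and the two coincide.) -/

import Mathlib

open MeasureTheory ProbabilityTheory InformationTheory
open scoped ENNReal

noncomputable section

namespace GJSHash

/-- A random hash function `h θ : M → B`, with `θ` distributed according to `μ`, is
`(r₁, r₂, p₁, p₂)`-sensitive for the divergence `D` on `M`. The measurability of the collision
events is part of the definition, so that the collision probabilities are genuine ones. -/
def IsSensitive {Θ M B : Type*} [MeasurableSpace Θ] (μ : Measure Θ) (h : Θ → M → B)
    (D : M → M → ℝ≥0∞) (r₁ r₂ p₁ p₂ : ℝ) : Prop :=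
  IsProbabilityMeasure μ ∧ r₁ < r₂ ∧ p₂ < p₁ ∧
    ∀ P Q : M, MeasurableSet {θ | h θ P = h θ Q} ∧
      (D P Q ≤ ENNReal.ofReal r₁ → p₁ ≤ μ.real {θ | h θ P = h θ Q}) ∧
      (ENNReal.ofReal r₂ < D P Q → μ.real {θ | h θ P = h θ Q} ≤ p₂)

/-- The mixture `M_λ = λ P + (1 - λ) Q`. -/
def mix {Ω : Type*} [MeasurableSpace Ω] (lam : ℝ) (P Q : ProbabilityMeasure Ω) : Measure Ω :=
  ENNReal.ofReal lam • (P : Measure Ω) + ENNReal.ofReal (1 - lam) • (Q : Measure Ω)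

/-- Generalized Jensen-Shannon divergence
`λ KL(P ‖ M_λ) + (1 - λ) KL(Q ‖ M_λ)` with parameter `λ`. -/
def gjs {Ω : Type*} [MeasurableSpace Ω] (lam : ℝ) (P Q : ProbabilityMeasure Ω) : ℝ≥0∞ :=
  ENNReal.ofReal lam * klDiv (P : Measure Ω) (mix lam P Q) +
    ENNReal.ofReal (1 - lam) * klDiv (Q : Measure Ω) (mix lam P Q)

/-- `η(λ) = -λ ln λ`. -/
def eta (lam : ℝ) : ℝ := -lam * Real.log lam

/-- `L(λ) = 2 min {η(λ), η(1 - λ)}`. -/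
def lowerConst (lam : ℝ) : ℝ := 2 * min (eta lam) (eta (1 - lam))

/-- `U(λ) = (2 λ (1 - λ) / (1 - 2 λ)) ln ((1 - λ) / λ)`, extended by continuity by
`U(1/2) = 1`. -/
def upperConst (lam : ℝ) : ℝ :=
  if lam = 1 / 2 then 1
  else 2 * lam * (1 - lam) / (1 - 2 * lam) * Real.log ((1 - lam) / lam)

/-- The vector `√P = (√P(i))_i` in Euclidean space. -/
def sqrtVec {Ω : Type*} [Fintype Ω] [MeasurableSpace Ω] (P : ProbabilityMeasure Ω) :
    EuclideanSpace ℝ Ω :=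
  WithLp.toLp 2 fun i => √((P : Measure Ω).real {i})

/-- The hash function `h_{a,b}(P) = ⌈(a · √P + b) / r⌉` of bucket width `r`, with `θ = (a, b)`. -/
def hash {Ω : Type*} [Fintype Ω] [MeasurableSpace Ω] (r : ℝ) (θ : EuclideanSpace ℝ Ω × ℝ)
    (P : ProbabilityMeasure Ω) : ℤ :=
  ⌈(inner ℝ θ.1 (sqrtVec P) + θ.2) / r⌉

/-- The law of `(a, b)`: `a` standard normal, `b` uniform on `[0, r]`, independent. -/
def hashLaw (Ω : Type*) [Fintype Ω] (r : ℝ) : Measure (EuclideanSpace ℝ Ω × ℝ) :=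
  (stdGaussian (EuclideanSpace ℝ Ω)).prod (cond volume (Set.Icc 0 r))

/-- Probability density function `f₂` of the absolute value of a standard normal variable. -/
def absNormalPDF (x : ℝ) : ℝ := if 0 ≤ x then 2 * gaussianPDFReal 0 1 x else 0

/-- `p(u) = ∫₀^r (1/u) f₂(t/u) (1 - t/r) dt`, for bucket width `r`. -/
def collisionProb (r u : ℝ) : ℝ :=
  ∫ t in (0 : ℝ)..r, 1 / u * absNormalPDF (t / u) * (1 - t / r)

end GJSHash

end

namespace GJSHash

/-! On a finite set the divergence is a sum over points `i` of `gjsTerm lam (P i) (Q i)`, and each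
term is squeezed between `lowerConst lam / 2` and `upperConst lam / 2` times `(√(P i) - √(Q i)) ^ 2`
(`le_gjsTerm`, `gjsTerm_le`). Summing, `D_λ` is comparable to the squared Euclidean distance of the
vectors `√P` and `√Q`, so a locality-sensitive hash for that distance is one for `D_λ`.

The upper bound becomes a one-variable inequality in hyperbolic functions once `λ = e^{-α} / (2 cosh
α)`. The lower bound is proved at `λ = 1/2` by calculus and carried to `λ < 1/2` by concavity in
`λ`; the swap of `P` and `Q` gives `λ > 1/2`.

For the hash, fix `a`: two projections at distance `d` share a bucket with probability `max 0 (1 - d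
/ r)` over the uniform shift. The difference of the projections is a centred Gaussian with standard
deviation `‖√P - √Q‖`, and averaging gives `collisionProb` (`hashLaw_real_collision`). It is
strictly decreasing in the distance, so the two distance bounds turn into the two probability
bounds. -/

/-- The contribution of one point to the generalized Jensen-Shannon divergence. -/
noncomputable def gjsTerm (lam p q : ℝ) : ℝ :=
  lam * (p * Real.log p) + (1 - lam) * (q * Real.log q) -
    (lam * p + (1 - lam) * q) * Real.log (lam * p + (1 - lam) * q)

lemma gjsTerm_symm (lam p q : ℝ) : gjsTerm lam p q = gjsTerm (1 - lam) q p := by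
  unfold gjsTerm
  rw [sub_sub_cancel, add_comm (lam * p) ((1 - lam) * q)]
  ring

lemma continuous_gjsTerm (lam : ℝ) : Continuous fun x : ℝ × ℝ => gjsTerm lam x.1 x.2 := by
  unfold gjsTerm
  refine ((continuous_const.mul (Real.continuous_mul_log.comp continuous_fst)).add
    (continuous_const.mul (Real.continuous_mul_log.comp continuous_snd))).sub
    (Real.continuous_mul_log.comp (g := fun x => x * Real.log x) ?_)
  fun_prop

/-- An inequality between continuous functions extends from the open to the closed quadrant. -/
lemma le_on_closed_quadrant {f g : ℝ × ℝ → ℝ} (hf : Continuous f) (hg : Continuous g)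
    (h : ∀ p q : ℝ, 0 < p → 0 < q → f (p, q) ≤ g (p, q)) {p q : ℝ} (hp : 0 ≤ p) (hq : 0 ≤ q) :
    f (p, q) ≤ g (p, q) := by
  have hcl : IsClosed {x | f x ≤ g x} := isClosed_le hf hg
  have hsub : Set.Ioi (0 : ℝ) ×ˢ Set.Ioi (0 : ℝ) ⊆ {x | f x ≤ g x} :=
    fun x hx => h x.1 x.2 hx.1 hx.2
  have := hcl.closure_subset_iff.2 hsub
  rw [closure_prod_eq, closure_Ioi] at this
  exact this (Set.mk_mem_prod hp hq)

/-! ### Upper bound -/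

lemma convexOn_sinh : ConvexOn ℝ (Set.Ici 0) Real.sinh := by
  refine convexOn_of_deriv2_nonneg (convex_Ici 0) Real.continuous_sinh.continuousOn
    Real.differentiable_sinh.differentiableOn ?_ ?_
  · rw [Real.deriv_sinh]; exact Real.differentiable_cosh.differentiableOn
  · intro x hx
    rw [interior_Ici] at hx
    simp only [Function.iterate_succ, Function.iterate_zero, Function.comp_apply, id,
      Real.deriv_sinh, Real.deriv_cosh]
    exact Real.sinh_nonneg_iff.2 (le_of_lt hx)

lemma mul_sinh_le_mul_sinh {x y : ℝ} (hx : 0 ≤ x) (hxy : x ≤ y) :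
    y * Real.sinh x ≤ x * Real.sinh y := by
  -- Convexity of `sinh` with `sinh 0 = 0` makes `sinh x / x` increasing.
  rcases hx.eq_or_lt with rfl | hx
  · simp
  have hy : 0 < y := hx.trans_le hxy
  have h := convexOn_sinh.2 (Set.mem_Ici.2 hy.le) (Set.mem_Ici.2 le_rfl)
    (show 0 ≤ x / y by positivity) (sub_nonneg.2 ((div_le_one hy).2 hxy)) (add_sub_cancel _ _)
  simp only [smul_eq_mul, mul_zero, add_zero, Real.sinh_zero, div_mul_cancel₀ _ hy.ne'] at h
  rw [div_mul_eq_mul_div, le_div_iff₀ hy] at h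
  linarith

/-- The ratio `α / sinh α`, extended by continuity. -/
noncomputable def invSinhc (α : ℝ) : ℝ := if α = 0 then 1 else α / Real.sinh α

lemma invSinhc_mul_sinh (α : ℝ) : invSinhc α * Real.sinh α = α := by
  unfold invSinhc
  split_ifs with h
  · simp [h]
  · exact div_mul_cancel₀ _ (by simpa [Real.sinh_eq_zero] using h)

lemma invSinhc_abs (α : ℝ) : invSinhc |α| = invSinhc α := by
  unfold invSinhc
  rcases abs_cases α with ⟨h, _⟩ | ⟨h, _⟩ <;> simp [h, Real.sinh_neg, neg_div_neg_eq]

lemma invSinhc_mul_sinh_le {α y : ℝ} (hy : 0 ≤ y) (h : y ≤ α) :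
    invSinhc α * Real.sinh y ≤ y := by
  unfold invSinhc
  split_ifs with h0
  · have : y = 0 := by linarith
    simp [this]
  · have hα : 0 < α := lt_of_le_of_ne (hy.trans h) (Ne.symm h0)
    rw [div_mul_eq_mul_div, div_le_iff₀ (Real.sinh_pos_iff.2 hα)]
    exact mul_sinh_le_mul_sinh hy h

lemma le_invSinhc_mul_sinh {α y : ℝ} (hα : 0 ≤ α) (h : α ≤ y) :
    y ≤ invSinhc α * Real.sinh y := by
  unfold invSinhc
  split_ifs with h0
  · rw [one_mul]; exact Real.self_le_sinh_iff.2 (hα.trans h)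
  · have hα : 0 < α := lt_of_le_of_ne hα (Ne.symm h0)
    rw [div_mul_eq_mul_div, le_div_iff₀ (Real.sinh_pos_iff.2 hα)]
    exact mul_sinh_le_mul_sinh hα.le h

lemma hasDerivAt_mul_tanh_sub_log_cosh (κ y : ℝ) :
    HasDerivAt (fun y => y * (Real.sinh y / Real.cosh y) - Real.log (Real.cosh y) +
      κ / Real.cosh y) ((y - κ * Real.sinh y) / Real.cosh y ^ 2) y := by
  have hc : Real.cosh y ≠ 0 := (Real.cosh_pos y).ne'
  have h := (((hasDerivAt_id y).mul ((Real.hasDerivAt_sinh y).div (Real.hasDerivAt_cosh y) hc)).sub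
    ((Real.hasDerivAt_cosh y).log hc)).add ((hasDerivAt_const y κ).div (Real.hasDerivAt_cosh y) hc)
  refine h.congr_deriv ?_
  have := Real.cosh_sq y
  simp only [id, Pi.div_apply]
  field_simp
  rw [this]
  ring

/-- The derivative has the sign of `y - κ sinh y` with `κ = α / sinh α`. Since `sinh y / y`
increases, the sign changes from plus to minus exactly at `y = α`, which is therefore the maximum.
-/
lemma mul_tanh_sub_log_cosh_le_of_nonneg {α y : ℝ} (hα : 0 ≤ α) (hy : 0 ≤ y) :
    y * (Real.sinh y / Real.cosh y) - Real.log (Real.cosh y) + invSinhc α / Real.cosh y ≤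
      α * (Real.sinh α / Real.cosh α) - Real.log (Real.cosh α) + invSinhc α / Real.cosh α := by
  have hd := hasDerivAt_mul_tanh_sub_log_cosh (invSinhc α)
  set K := fun y => y * (Real.sinh y / Real.cosh y) - Real.log (Real.cosh y) +
    invSinhc α / Real.cosh y with hK
  have hcont : Continuous K := continuous_iff_continuousAt.2 fun x => (hd x).continuousAt
  change K y ≤ K α
  rcases le_total y α with h | h
  · refine monotoneOn_of_deriv_nonneg (convex_Icc 0 α) hcont.continuousOn
      (fun x _ => (hd x).differentiableAt.differentiableWithinAt) ?_ ⟨hy, h⟩ ⟨hα, le_rfl⟩ h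
    intro x hx
    rw [interior_Icc] at hx
    rw [(hd x).deriv]
    exact div_nonneg (sub_nonneg.2 (invSinhc_mul_sinh_le hx.1.le hx.2.le)) (sq_nonneg _)
  · refine antitoneOn_of_deriv_nonpos (convex_Ici α) hcont.continuousOn
      (fun x _ => (hd x).differentiableAt.differentiableWithinAt) ?_ (Set.mem_Ici.2 le_rfl) h h
    intro x hx
    rw [interior_Ici] at hx
    rw [(hd x).deriv]
    exact div_nonpos_of_nonpos_of_nonneg
      (sub_nonpos.2 (le_invSinhc_mul_sinh hα (le_of_lt hx))) (sq_nonneg _)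

/-- The previous inequality multiplied by `cosh y`; evenness in `α` and in `y` removes the sign
conditions. The maximal value simplifies by `κ sinh α = α` and `cosh² = 1 + sinh²`. -/
lemma mul_sinh_sub_cosh_mul_log_le (α y : ℝ) :
    y * Real.sinh y - Real.cosh y * (Real.log (Real.cosh y) - Real.log (Real.cosh α)) ≤
      invSinhc α * (Real.cosh y * Real.cosh α - 1) := by
  have habs : ∀ x : ℝ, |x| * (Real.sinh |x| / Real.cosh |x|) = x * (Real.sinh x / Real.cosh x) := by
    intro x
    rcases abs_cases x with ⟨h, _⟩ | ⟨h, _⟩ <;> simp [h, Real.sinh_neg, neg_div]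
  have h := mul_tanh_sub_log_cosh_le_of_nonneg (abs_nonneg α) (abs_nonneg y)
  rw [habs, habs, Real.cosh_abs, Real.cosh_abs, invSinhc_abs] at h
  have hy := Real.cosh_pos y
  have hα := Real.cosh_pos α
  have e : α * (Real.sinh α / Real.cosh α) + invSinhc α / Real.cosh α =
      invSinhc α * Real.cosh α := by
    field_simp
    linear_combination -Real.sinh α * invSinhc_mul_sinh α - invSinhc α * Real.cosh_sq α
  have h2 := mul_le_mul_of_nonneg_left h hy.le
  have e2 : Real.cosh y * (y * (Real.sinh y / Real.cosh y) - Real.log (Real.cosh y) +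
      invSinhc α / Real.cosh y) = y * Real.sinh y - Real.cosh y * Real.log (Real.cosh y) +
      invSinhc α := by field_simp
  rw [e2] at h2
  have e3 : α * (Real.sinh α / Real.cosh α) - Real.log (Real.cosh α) + invSinhc α / Real.cosh α =
    invSinhc α * Real.cosh α - Real.log (Real.cosh α) := by linarith
  rw [e3] at h2
  linarith

/-! ### Writing `λ` through half its log-odds -/

section Parametrization

variable {lam : ℝ}

lemma lam_eq_exp (h0 : 0 < lam) (h1 : lam < 1) :
    lam = Real.exp (-(Real.log ((1 - lam) / lam) / 2)) /
      (2 * Real.cosh (Real.log ((1 - lam) / lam) / 2)) := by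
  set α := Real.log ((1 - lam) / lam) / 2 with hα
  have hw : 0 < 1 - lam := by linarith
  have h : Real.exp α * Real.exp α = (1 - lam) / lam := by
    rw [← Real.exp_add, hα, add_halves, Real.exp_log (by positivity)]
  have he := Real.exp_pos α
  rw [Real.cosh_eq, Real.exp_neg]
  field_simp
  rw [eq_div_iff h0.ne'] at h
  nlinarith

lemma one_sub_lam_eq_exp (h0 : 0 < lam) (h1 : lam < 1) :
    1 - lam = Real.exp (Real.log ((1 - lam) / lam) / 2) /
      (2 * Real.cosh (Real.log ((1 - lam) / lam) / 2)) := by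
  conv_lhs => rw [lam_eq_exp h0 h1]
  have := Real.cosh_pos (Real.log ((1 - lam) / lam) / 2)
  rw [eq_div_iff (by positivity), sub_mul, div_mul_cancel₀ _ (by positivity), Real.cosh_eq]
  ring

lemma upperConst_eq (h0 : 0 < lam) (h1 : lam < 1) :
    upperConst lam = invSinhc (Real.log ((1 - lam) / lam) / 2) /
      Real.cosh (Real.log ((1 - lam) / lam) / 2) := by
  unfold upperConst
  split_ifs with h
  · subst h
    norm_num [invSinhc]
  have e1 := lam_eq_exp h0 h1
  have e2 := one_sub_lam_eq_exp h0 h1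
  set L := Real.log ((1 - lam) / lam) with hL
  obtain ⟨α, hα⟩ : ∃ α, α = L / 2 := ⟨_, rfl⟩
  have hw : 0 < 1 - lam := by linarith
  have hL0 : L ≠ 0 := by
    intro hz
    rcases Real.log_eq_zero.1 hz with h' | h' | h'
    · exact (div_pos hw h0).ne' h'
    · rw [div_eq_one_iff_eq h0.ne'] at h'
      exact h (by linarith)
    · have := div_pos hw h0
      linarith
  rw [← hα] at e1 e2 ⊢
  have hα0 : α ≠ 0 := by rw [hα]; simpa using hL0
  have hc := Real.cosh_pos α
  have hs : Real.sinh α ≠ 0 := by simpa [Real.sinh_eq_zero] using hα0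
  have hd : 1 - 2 * lam = Real.sinh α / Real.cosh α := by
    have : 1 - 2 * lam = (1 - lam) - lam := by ring
    rw [this, e2, Real.sinh_eq, eq_comm, ← sub_eq_zero]
    nth_rewrite 1 [e1]
    field_simp
    ring
  have hp : lam * (1 - lam) = 1 / (4 * Real.cosh α ^ 2) := by
    rw [e2]; nth_rewrite 1 [e1]
    rw [Real.exp_neg]
    have := Real.exp_pos α
    field_simp
    norm_num
  have hLα : L = 2 * α := by rw [hα]; ring
  rw [hd, hLα, invSinhc, if_neg hα0, mul_assoc 2 lam, hp]
  field_simp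
  norm_num

end Parametrization

/-- With `p, q = e^{l ± (y + α)}`, the weights absorb the shift by `α`: `λp` and `(1 - λ)q` become
`e^{l ± y} / (2 cosh α)`, and their sum is `e^l cosh y / cosh α`. The factor `e^l / cosh α` then
comes out of both sides, leaving an inequality in `y` and `α` only. -/
lemma gjsTerm_le_of_pos {lam p q : ℝ} (h0 : 0 < lam) (h1 : lam < 1) (hp : 0 < p) (hq : 0 < q) :
    gjsTerm lam p q ≤ upperConst lam / 2 * (√p - √q) ^ 2 := by
  have e1 := lam_eq_exp h0 h1
  have e2 := one_sub_lam_eq_exp h0 h1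
  rw [upperConst_eq h0 h1]
  set α := Real.log ((1 - lam) / lam) / 2
  obtain ⟨l, hl⟩ : ∃ l, l = (Real.log p + Real.log q) / 2 := ⟨_, rfl⟩
  obtain ⟨y, hy⟩ : ∃ y, y = (Real.log p - Real.log q) / 2 - α := ⟨_, rfl⟩
  have hlp : Real.log p = l + (y + α) := by rw [hl, hy]; ring
  have hlq : Real.log q = l - (y + α) := by rw [hl, hy]; ring
  have hpe : p = Real.exp l * Real.exp (y + α) := by
    rw [← Real.exp_add, ← hlp, Real.exp_log hp]
  have hqe : q = Real.exp l * Real.exp (-(y + α)) := by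
    rw [← Real.exp_add, ← sub_eq_add_neg, ← hlq, Real.exp_log hq]
  have hc := Real.cosh_pos α
  have hcy := Real.cosh_pos y
  have hg := Real.exp_pos l
  have hA : lam * p = Real.exp l * Real.exp y / (2 * Real.cosh α) := by
    rw [hpe, Real.exp_add, e1, Real.exp_neg]
    have := Real.exp_pos α
    field_simp
  have hB : (1 - lam) * q = Real.exp l * Real.exp (-y) / (2 * Real.cosh α) := by
    rw [hqe, e2, neg_add, Real.exp_add, Real.exp_neg α]
    have := Real.exp_pos α
    field_simp
  have hm : lam * p + (1 - lam) * q = Real.exp l * Real.cosh y / Real.cosh α := by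
    rw [hA, hB, Real.cosh_eq y]
    field_simp
  have hlm : Real.log (Real.exp l * Real.cosh y / Real.cosh α) =
      l + Real.log (Real.cosh y) - Real.log (Real.cosh α) := by
    rw [Real.log_div (by positivity) hc.ne', Real.log_mul hg.ne' hcy.ne', Real.log_exp]
  have hleft : gjsTerm lam p q = Real.exp l / Real.cosh α * ((y + α) * Real.sinh y -
      Real.cosh y * (Real.log (Real.cosh y) - Real.log (Real.cosh α))) := by
    unfold gjsTerm
    rw [← mul_assoc, ← mul_assoc, hm, hA, hB, hlm, hlp, hlq, Real.sinh_eq, Real.cosh_eq y]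
    field_simp
    ring
  have hsq : √p * √q = Real.exp l := by
    rw [← Real.sqrt_mul hp.le, hpe, hqe]
    rw [show Real.exp l * Real.exp (y + α) * (Real.exp l * Real.exp (-(y + α))) =
      Real.exp l * Real.exp l * (Real.exp (y + α) * Real.exp (-(y + α))) by ring, ← Real.exp_add (y + α),
      add_neg_cancel, Real.exp_zero, mul_one, Real.sqrt_mul_self hg.le]
  have hright : (√p - √q) ^ 2 = 2 * Real.exp l * (Real.cosh (y + α) - 1) := by
    have : (√p - √q) ^ 2 = p + q - 2 * Real.exp l := by
      rw [← hsq, sub_sq, Real.sq_sqrt hp.le, Real.sq_sqrt hq.le]; ring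
    rw [this, Real.cosh_eq]
    nth_rewrite 1 [hpe]
    nth_rewrite 1 [hqe]
    ring
  have hr2 : invSinhc α / Real.cosh α / 2 * (2 * Real.exp l * (Real.cosh (y + α) - 1)) =
      Real.exp l / Real.cosh α * (invSinhc α * (Real.cosh (y + α) - 1)) := by
    field_simp
  rw [hleft, hright, hr2]
  refine mul_le_mul_of_nonneg_left ?_ (by positivity)
  have h := mul_sinh_sub_cosh_mul_log_le α y
  have hk := invSinhc_mul_sinh α
  -- The cross term `κ sinh y sinh α = α sinh y` cancels the same term on the left.
  rw [Real.cosh_add]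
  have : invSinhc α * (Real.cosh y * Real.cosh α + Real.sinh y * Real.sinh α - 1) =
    invSinhc α * (Real.cosh y * Real.cosh α - 1) + α * Real.sinh y := by
    linear_combination Real.sinh y * hk
  rw [this]
  linarith

lemma gjsTerm_le {lam p q : ℝ} (h0 : 0 < lam) (h1 : lam < 1) (hp : 0 ≤ p) (hq : 0 ≤ q) :
    gjsTerm lam p q ≤ upperConst lam / 2 * (√p - √q) ^ 2 :=
  le_on_closed_quadrant (f := fun x => gjsTerm lam x.1 x.2)
    (g := fun x => upperConst lam / 2 * (√x.1 - √x.2) ^ 2) (continuous_gjsTerm lam) (by fun_prop)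
    (fun _ _ hp hq => gjsTerm_le_of_pos h0 h1 hp hq) hp hq

/-! ### Lower bound -/

lemma eta_pos {x : ℝ} (h0 : 0 < x) (h1 : x < 1) : 0 < eta x := by
  unfold eta
  nlinarith [Real.log_neg h0 h1]

lemma convexOn_mul_log_add :
    ConvexOn ℝ (Set.Icc 0 1) fun s : ℝ => s * Real.log s + Real.log 2 / 2 * (1 - s ^ 2) := by
  refine convexOn_of_hasDerivWithinAt2_nonneg (convex_Icc 0 1)
    (f' := fun s => Real.log s + 1 - Real.log 2 * s) (f'' := fun s => s⁻¹ - Real.log 2) ?_ ?_ ?_ ?_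
  · exact (Real.continuous_mul_log.add (by fun_prop)).continuousOn
  · intro x hx
    rw [interior_Icc] at hx
    refine HasDerivAt.hasDerivWithinAt ?_
    refine ((Real.hasDerivAt_mul_log hx.1.ne').add
      (((hasDerivAt_pow 2 x).const_sub 1).const_mul (Real.log 2 / 2))).congr_deriv ?_
    simp; ring
  · intro x hx
    rw [interior_Icc] at hx
    refine HasDerivAt.hasDerivWithinAt ?_
    refine (((Real.hasDerivAt_log hx.1.ne').add_const 1).sub
      ((hasDerivAt_id x).const_mul (Real.log 2))).congr_deriv ?_
    simp
  · intro x hx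
    rw [interior_Icc] at hx
    have : 1 ≤ x⁻¹ := (one_le_inv₀ hx.1).2 hx.2.le
    have := Real.log_two_lt_d9
    linarith

/-- This function vanishes at `0` and `1`, and its derivative is a positive multiple of the convex
function `ψ`, with `ψ 1 = 0`. A negative value would force `ψ < 0` somewhere before `s` and `ψ > 0`
somewhere after it, which convexity and `ψ 1 = 0` exclude. The grouping `s * log s` keeps continuity
at `0` visible. -/
lemma half_divergence_ratio_nonneg {s : ℝ} (h0 : 0 ≤ s) (h1 : s ≤ 1) :
    0 ≤ 2 * s * (s * Real.log s) / (s ^ 2 + 1) - Real.log (s ^ 2 + 1) +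
      2 * Real.log 2 * s / (s ^ 2 + 1) := by
  set K : ℝ → ℝ := fun s => 2 * s * (s * Real.log s) / (s ^ 2 + 1) - Real.log (s ^ 2 + 1) +
      2 * Real.log 2 * s / (s ^ 2 + 1) with hK
  set ψ : ℝ → ℝ := fun s => s * Real.log s + Real.log 2 / 2 * (1 - s ^ 2) with hψ
  have hpos : ∀ x : ℝ, x ^ 2 + 1 ≠ 0 := fun x => by positivity
  have hcont : Continuous K := by
    refine ((((continuous_const.mul continuous_id).mul Real.continuous_mul_log).div (by fun_prop)
      hpos).sub (Continuous.log (by fun_prop) hpos)).add (Continuous.div (by fun_prop)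
      (by fun_prop) hpos)
  have hd : ∀ x : ℝ, 0 < x → HasDerivAt K (4 * ψ x / (x ^ 2 + 1) ^ 2) x := by
    intro x hx
    have hq : HasDerivAt (fun x : ℝ => x ^ 2 + 1) (2 * x) x := by
      simpa using (hasDerivAt_pow 2 x).add_const 1
    have h := (((((hasDerivAt_id x).const_mul 2).mul (Real.hasDerivAt_mul_log hx.ne')).div hq
      (hpos x)).sub (hq.log (hpos x))).add (((hasDerivAt_id x).const_mul (2 * Real.log 2)).div hq
      (hpos x))
    refine h.congr_deriv ?_
    simp only [hψ, id, Pi.mul_apply, mul_one]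
    have := hpos x
    field_simp
    ring
  change 0 ≤ K s
  have hK0 : K 0 = 0 := by simp [hK]
  have hK1 : K 1 = 0 := by norm_num [hK]
  by_contra! hneg
  have hs0 : 0 < s := h0.lt_of_ne (by rintro rfl; linarith)
  have hs1 : s < 1 := h1.lt_of_ne (by rintro rfl; linarith)
  obtain ⟨x, hx, hxe⟩ := exists_hasDerivAt_eq_slope K _ hs0 hcont.continuousOn
    fun x hx => hd x hx.1
  obtain ⟨y, hy, hye⟩ := exists_hasDerivAt_eq_slope K _ hs1 hcont.continuousOn
    fun x hx => hd x (hs0.trans hx.1)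
  rw [hK0, sub_zero, sub_zero] at hxe
  rw [hK1, zero_sub] at hye
  have hx' : ψ x < 0 := by
    have h1 : 4 * ψ x / (x ^ 2 + 1) ^ 2 < 0 := hxe ▸ div_neg_of_neg_of_pos hneg hs0
    rw [div_neg_iff] at h1
    rcases h1 with h1 | h1
    · have : 0 < (x ^ 2 + 1) ^ 2 := by positivity
      linarith
    · linarith
  have hy' : 0 < ψ y := by
    have h1 : 0 < 4 * ψ y / (y ^ 2 + 1) ^ 2 :=
      hye ▸ div_pos (neg_pos.2 hneg) (sub_pos.2 hs1)
    have h2 := (div_pos_iff_of_pos_right (by positivity)).1 h1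
    linarith
  have := convexOn_mul_log_add.le_max_of_mem_Icc (x := x) (y := 1) (z := y)
    ⟨hx.1.le, (hx.2.trans hs1).le⟩ ⟨zero_le_one, le_rfl⟩ ⟨(hx.2.trans hy.1).le, hy.2.le⟩
  change ψ y ≤ max (ψ x) (ψ 1) at this
  have hψ1 : ψ 1 = 0 := by simp [hψ]
  rw [hψ1, max_eq_right hx'.le] at this
  linarith

lemma log_two_mul_le_gjsTerm_half_of_le {p q : ℝ} (hp : 0 < p) (hpq : p ≤ q) :
    Real.log 2 / 2 * (√p - √q) ^ 2 ≤ gjsTerm (1 / 2) p q := by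
  have hq : 0 < q := hp.trans_le hpq
  -- Homogeneity leaves only the ratio `s = √p / √q`, at most `1` by the ordering of `p` and `q`.
  obtain ⟨s, hs⟩ : ∃ s, s = √p / √q := ⟨_, rfl⟩
  have hsp : 0 < √p := Real.sqrt_pos.2 hp
  have hsq : 0 < √q := Real.sqrt_pos.2 hq
  have hs0 : 0 < s := by rw [hs]; positivity
  have hs1 : s ≤ 1 := by rw [hs, div_le_one hsq]; exact Real.sqrt_le_sqrt hpq
  have hps : √p = s * √q := by rw [hs, div_mul_cancel₀ _ hsq.ne']
  have hp2 : p = s ^ 2 * q := by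
    rw [← Real.sq_sqrt hp.le, hps, mul_pow, Real.sq_sqrt hq.le]
  have h := half_divergence_ratio_nonneg hs0.le hs1
  have hn : 0 < s ^ 2 + 1 := by positivity
  have hlp : Real.log p = 2 * Real.log s + Real.log q := by
    rw [hp2, Real.log_mul (by positivity) hq.ne', Real.log_pow]; norm_num
  have hm : 1 / 2 * p + (1 - 1 / 2) * q = q * (s ^ 2 + 1) / 2 := by rw [hp2]; ring
  have hlm : Real.log (q * (s ^ 2 + 1) / 2) = Real.log q + Real.log (s ^ 2 + 1) - Real.log 2 := by
    rw [Real.log_div (by positivity) two_ne_zero, Real.log_mul hq.ne' hn.ne']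
  have e1 : (√p - √q) ^ 2 = q * (s - 1) ^ 2 := by
    rw [hps, ← Real.sq_sqrt hq.le, Real.sqrt_sq (Real.sqrt_nonneg _)]; ring
  have e2 : gjsTerm (1 / 2) p q = Real.log 2 / 2 * (q * (s - 1) ^ 2) + q * (s ^ 2 + 1) / 2 *
      (2 * s * (s * Real.log s) / (s ^ 2 + 1) - Real.log (s ^ 2 + 1) +
      2 * Real.log 2 * s / (s ^ 2 + 1)) := by
    unfold gjsTerm
    rw [hm, hlm, hlp, hp2]
    field_simp
    ring
  rw [e1, e2]
  have : 0 ≤ q * (s ^ 2 + 1) / 2 := by positivity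
  linarith [mul_nonneg this h]

lemma log_two_mul_le_gjsTerm_half {p q : ℝ} (hp : 0 < p) (hq : 0 < q) :
    Real.log 2 / 2 * (√p - √q) ^ 2 ≤ gjsTerm (1 / 2) p q := by
  rcases le_total p q with h | h
  · exact log_two_mul_le_gjsTerm_half_of_le hp h
  · have := log_two_mul_le_gjsTerm_half_of_le hq h
    rw [gjsTerm_symm, sub_sq_comm]
    norm_num at this ⊢
    exact this

/-- The second derivative in `x` is `(√p - √q)² (1 / (1 - x) - (√p + √q)² / m)` with `m = xp + (1 -
x)q`. For `x ≤ 1/2` one has `m ≤ (1 - x)(p + q) ≤ (1 - x)(√p + √q)²`, so it is nonpositive. -/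
lemma concaveOn_gjsTerm_sub {p q : ℝ} (hp : 0 < p) (hq : 0 < q) :
    ConcaveOn ℝ (Set.Icc 0 (1 / 2)) fun x => gjsTerm x p q - eta (1 - x) * (√p - √q) ^ 2 := by
  have hm : ∀ x ∈ Set.Icc (0 : ℝ) (1 / 2), 0 < x * p + (1 - x) * q := by
    intro x hx
    have := hx.1
    have : 0 < 1 - x := by linarith [hx.2]
    positivity
  have hdm : ∀ x : ℝ, HasDerivAt (fun x => x * p + (1 - x) * q) (p - q) x := fun x =>
    (((hasDerivAt_id x).mul_const p).add (((hasDerivAt_id x).const_sub 1).mul_const q)).congr_deriv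
      (by ring)
  refine concaveOn_of_hasDerivWithinAt2_nonpos (convex_Icc _ _)
    (f' := fun x => p * Real.log p - q * Real.log q -
      (Real.log (x * p + (1 - x) * q) + 1) * (p - q) - (Real.log (1 - x) + 1) * (√p - √q) ^ 2)
    (f'' := fun x => -((p - q) / (x * p + (1 - x) * q)) * (p - q) + 1 / (1 - x) * (√p - √q) ^ 2)
    ?_ ?_ ?_ ?_
  · unfold gjsTerm eta
    refine Continuous.continuousOn ?_
    refine (((by fun_prop : Continuous fun x => x * (p * Real.log p) +
      (1 - x) * (q * Real.log q))).sub (Real.continuous_mul_log.comp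
      (by fun_prop : Continuous fun x => x * p + (1 - x) * q))).sub (Continuous.mul ?_ (by fun_prop))
    have : (fun x : ℝ => -(1 - x) * Real.log (1 - x)) = fun x => -((1 - x) * Real.log (1 - x)) := by
      ext x; ring
    rw [this]
    exact (Real.continuous_mul_log.comp (by fun_prop : Continuous fun x : ℝ => 1 - x)).neg
  · intro x hx
    rw [interior_Icc] at hx
    have h1x : 1 - x ≠ 0 := by linarith [hx.2]
    have h1 := (Real.hasDerivAt_mul_log (hm x ⟨hx.1.le, hx.2.le⟩).ne').comp x (hdm x)
    have h2 := (Real.hasDerivAt_mul_log h1x).comp x ((hasDerivAt_id x).const_sub 1)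
    have h3 := (((((hasDerivAt_id x).mul_const (p * Real.log p)).add
      (((hasDerivAt_id x).const_sub 1).mul_const (q * Real.log q))).sub h1).add
      (h2.mul_const ((√p - √q) ^ 2)))
    refine HasDerivAt.hasDerivWithinAt ?_
    refine (h3.congr_deriv ?_).congr_of_eventuallyEq (Filter.Eventually.of_forall fun y => ?_)
    · ring
    · simp [gjsTerm, eta]; ring
  · intro x hx
    rw [interior_Icc] at hx
    have h1x : 1 - x ≠ 0 := by linarith [hx.2]
    have h1 := (hdm x).log (hm x ⟨hx.1.le, hx.2.le⟩).ne'
    have h2 := ((hasDerivAt_id x).const_sub 1).log h1x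
    refine HasDerivAt.hasDerivWithinAt ?_
    refine ((((h1.add_const 1).mul_const (p - q)).const_sub (p * Real.log p - q * Real.log q)).sub
      ((h2.add_const 1).mul_const ((√p - √q) ^ 2))).congr_deriv ?_
    simp only [id]
    ring
  · intro x hx
    rw [interior_Icc] at hx
    have h1x : 0 < 1 - x := by linarith [hx.2]
    have hmx := hm x ⟨hx.1.le, hx.2.le⟩
    have hpq : p - q = (√p - √q) * (√p + √q) := by
      rw [← Real.sq_sqrt hp.le, ← Real.sq_sqrt hq.le, Real.sqrt_sq (Real.sqrt_nonneg _),
        Real.sqrt_sq (Real.sqrt_nonneg _)]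
      ring
    have hle : x * p + (1 - x) * q ≤ (√p + √q) ^ 2 * (1 - x) := by
      have : (√p + √q) ^ 2 = p + q + 2 * (√p * √q) := by
        rw [add_sq, Real.sq_sqrt hp.le, Real.sq_sqrt hq.le]; ring
      rw [this]
      have h1 : 0 ≤ √p * √q * (1 - x) := by positivity
      nlinarith [hx.2]
    have : -((p - q) / (x * p + (1 - x) * q)) * (p - q) + 1 / (1 - x) * (√p - √q) ^ 2 =
        (√p - √q) ^ 2 * (x * p + (1 - x) * q - (√p + √q) ^ 2 * (1 - x)) /
          ((x * p + (1 - x) * q) * (1 - x)) := by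
      have e : -((p - q) / (x * p + (1 - x) * q)) * (p - q) =
        -((p - q) ^ 2 / (x * p + (1 - x) * q)) := by ring
      rw [e, hpq]
      field_simp
      ring
    rw [this]
    exact div_nonpos_of_nonpos_of_nonneg
      (mul_nonpos_of_nonneg_of_nonpos (sq_nonneg _) (by linarith)) (by positivity)

/-- A concave function on `[0, 1/2]` is at least the smaller of its endpoint values: here zero at
`0`, and nonnegative at `1/2` because `η(1/2) = ln 2 / 2`. -/
lemma eta_mul_le_gjsTerm {lam p q : ℝ} (h0 : 0 ≤ lam) (h1 : lam ≤ 1 / 2) (hp : 0 < p) (hq : 0 < q) :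
    eta (1 - lam) * (√p - √q) ^ 2 ≤ gjsTerm lam p q := by
  have h := (concaveOn_gjsTerm_sub hp hq).min_le_of_mem_Icc (x := 0) (y := 1 / 2) (z := lam)
    ⟨le_rfl, by norm_num⟩ ⟨by norm_num, le_rfl⟩ ⟨h0, h1⟩
  have e0 : gjsTerm 0 p q - eta (1 - 0) * (√p - √q) ^ 2 = 0 := by simp [gjsTerm, eta]
  have e1 : 0 ≤ gjsTerm (1 / 2) p q - eta (1 - 1 / 2) * (√p - √q) ^ 2 := by
    have := log_two_mul_le_gjsTerm_half hp hq
    have h2 : eta (1 - 1 / 2) = Real.log 2 / 2 := by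
      rw [eta, show (1 : ℝ) - 1 / 2 = 2⁻¹ by norm_num, Real.log_inv]; ring
    rw [h2]; linarith
  rw [e0, min_eq_left e1] at h
  linarith

lemma le_gjsTerm {lam p q : ℝ} (h0 : 0 < lam) (h1 : lam < 1) (hp : 0 ≤ p) (hq : 0 ≤ q) :
    lowerConst lam / 2 * (√p - √q) ^ 2 ≤ gjsTerm lam p q := by
  refine le_on_closed_quadrant (f := fun x => lowerConst lam / 2 * (√x.1 - √x.2) ^ 2)
    (g := fun x => gjsTerm lam x.1 x.2) (by fun_prop) (continuous_gjsTerm lam) ?_ hp hq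
  intro p q hp hq
  simp only [lowerConst, mul_div_cancel_left₀ _ (two_ne_zero' ℝ)]
  rcases le_total lam (1 / 2) with h | h
  · exact (mul_le_mul_of_nonneg_right (min_le_right _ _) (sq_nonneg _)).trans
      (eta_mul_le_gjsTerm h0.le h hp hq)
  · have := eta_mul_le_gjsTerm (lam := 1 - lam) (by linarith) (by linarith) hq hp
    rw [sub_sub_cancel, sub_sq_comm, ← gjsTerm_symm] at this
    exact (mul_le_mul_of_nonneg_right (min_le_left _ _) (sq_nonneg _)).trans this

lemma lowerConst_pos {lam : ℝ} (h0 : 0 < lam) (h1 : lam < 1) : 0 < lowerConst lam :=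
  mul_pos two_pos (lt_min (eta_pos h0 h1) (eta_pos (by linarith) (by linarith)))

lemma lowerConst_le_upperConst {lam : ℝ} (h0 : 0 < lam) (h1 : lam < 1) :
    lowerConst lam ≤ upperConst lam := by
  -- Both pointwise bounds are compared at `p = 1`, `q = 0`.
  have h := (le_gjsTerm h0 h1 zero_le_one le_rfl).trans (gjsTerm_le h0 h1 zero_le_one le_rfl)
  simp at h
  linarith

/-! ### The divergence on a finite set -/

section Divergence

variable {Ω : Type*} [MeasurableSpace Ω]

lemma klDiv_eq_sum [Fintype Ω] [MeasurableSingletonClass Ω] {μ ν : Measure Ω}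
    [IsFiniteMeasure μ] [IsFiniteMeasure ν] (h : μ ≪ ν) :
    klDiv μ ν = ∑ i, ENNReal.ofReal (ν.real {i} * klFun (μ.real {i} / ν.real {i})) := by
  rw [klDiv_eq_lintegral_klFun_of_ac h, lintegral_fintype]
  refine Finset.sum_congr rfl fun i _ => ?_
  rcases eq_or_ne (ν {i}) 0 with h0 | h0
  · simp [h0, Measure.real]
  have hrn : μ.rnDeriv ν i * ν {i} = μ {i} := by
    rw [← Measure.setLIntegral_rnDeriv h {i}, lintegral_singleton]
  have hpos : 0 < ν.real {i} := ENNReal.toReal_pos h0 (measure_ne_top _ _)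
  have hr : (μ.rnDeriv ν i).toReal = μ.real {i} / ν.real {i} := by
    rw [eq_div_iff hpos.ne', Measure.real, Measure.real, ← ENNReal.toReal_mul, hrn]
  rw [hr, mul_comm, ENNReal.ofReal_mul hpos.le, ofReal_measureReal]

/-- `klFun x = x log x + 1 - x` carries a linear correction; its weighted sum vanishes because `m`
is the mean of `p` and `q`. -/
lemma mul_klFun_add_mul_klFun {lam p q : ℝ} (h0 : 0 < lam) (h1 : lam < 1) (hp : 0 ≤ p)
    (hq : 0 ≤ q) :
    lam * ((lam * p + (1 - lam) * q) * klFun (p / (lam * p + (1 - lam) * q))) +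
      (1 - lam) * ((lam * p + (1 - lam) * q) * klFun (q / (lam * p + (1 - lam) * q))) =
      gjsTerm lam p q := by
  have hw : 0 < 1 - lam := by linarith
  unfold gjsTerm
  obtain ⟨m, hm⟩ : ∃ m, m = lam * p + (1 - lam) * q := ⟨_, rfl⟩
  rw [← hm]
  have hm0 : 0 ≤ m := by rw [hm]; positivity
  rcases hm0.eq_or_lt with h | h
  · have hlp : 0 ≤ lam * p := by positivity
    have hlq : 0 ≤ (1 - lam) * q := by positivity
    have hp0 : p = 0 := (mul_eq_zero.1 (show lam * p = 0 by linarith)).resolve_left h0.ne'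
    have hq0 : q = 0 := (mul_eq_zero.1 (show (1 - lam) * q = 0 by linarith)).resolve_left hw.ne'
    simp [hp0, hq0, ← h]
  · have key : ∀ x : ℝ, 0 ≤ x → m * klFun (x / m) = x * Real.log x - x * Real.log m + m - x := by
      intro x hx
      rw [klFun_apply]
      rcases hx.eq_or_lt with rfl | hx
      · simp
      · rw [Real.log_div hx.ne' h.ne']; field_simp
    rw [key p hp, key q hq]
    linear_combination (Real.log m + 1) * hm

lemma real_mix_singleton {lam : ℝ} (h0 : 0 < lam) (h1 : lam < 1) (P Q : ProbabilityMeasure Ω)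
    (i : Ω) : (mix lam P Q).real {i} =
      lam * (P : Measure Ω).real {i} + (1 - lam) * (Q : Measure Ω).real {i} := by
  have : ENNReal.ofReal lam * (P : Measure Ω) {i} ≠ ∞ :=
    ENNReal.mul_ne_top ENNReal.ofReal_ne_top (measure_ne_top _ _)
  have : ENNReal.ofReal (1 - lam) * (Q : Measure Ω) {i} ≠ ∞ :=
    ENNReal.mul_ne_top ENNReal.ofReal_ne_top (measure_ne_top _ _)
  simp only [mix, Measure.real, Measure.add_apply, Measure.smul_apply, smul_eq_mul]
  rw [ENNReal.toReal_add ‹_› ‹_›, ENNReal.toReal_mul, ENNReal.toReal_mul,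
    ENNReal.toReal_ofReal h0.le, ENNReal.toReal_ofReal (by linarith)]

lemma gjs_eq_sum [Fintype Ω] [MeasurableSingletonClass Ω] {lam : ℝ} (h0 : 0 < lam)
    (h1 : lam < 1) (P Q : ProbabilityMeasure Ω) :
    gjs lam P Q = ENNReal.ofReal
      (∑ i, gjsTerm lam ((P : Measure Ω).real {i}) ((Q : Measure Ω).real {i})) := by
  have hw : 0 < 1 - lam := by linarith
  have : IsFiniteMeasure (mix lam P Q) := by
    unfold mix
    have := Measure.smul_finite (P : Measure Ω) (ENNReal.ofReal_ne_top (r := lam))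
    have := Measure.smul_finite (Q : Measure Ω) (ENNReal.ofReal_ne_top (r := 1 - lam))
    infer_instance
  have hP : (P : Measure Ω) ≪ mix lam P Q := by
    intro s hs
    have : ENNReal.ofReal lam ≠ 0 := by simpa using h0
    simp only [mix, Measure.add_apply, Measure.smul_apply, smul_eq_mul, add_eq_zero,
      mul_eq_zero] at hs
    tauto
  have hQ : (Q : Measure Ω) ≪ mix lam P Q := by
    intro s hs
    have : ENNReal.ofReal (1 - lam) ≠ 0 := by simpa using hw
    simp only [mix, Measure.add_apply, Measure.smul_apply, smul_eq_mul, add_eq_zero,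
      mul_eq_zero] at hs
    tauto
  have hkl : ∀ x m : ℝ, 0 ≤ x → 0 ≤ m → 0 ≤ m * klFun (x / m) := fun x m hx hm =>
    mul_nonneg hm (klFun_nonneg (div_nonneg hx hm))
  rw [gjs, klDiv_eq_sum hP, klDiv_eq_sum hQ, Finset.mul_sum, Finset.mul_sum,
    ← Finset.sum_add_distrib, ENNReal.ofReal_sum_of_nonneg]
  · refine Finset.sum_congr rfl fun i _ => ?_
    rw [← ENNReal.ofReal_mul h0.le, ← ENNReal.ofReal_mul hw.le, ← ENNReal.ofReal_add
      (mul_nonneg h0.le (hkl _ _ measureReal_nonneg measureReal_nonneg))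
      (mul_nonneg hw.le (hkl _ _ measureReal_nonneg measureReal_nonneg)),
      real_mix_singleton h0 h1, mul_klFun_add_mul_klFun h0 h1 measureReal_nonneg measureReal_nonneg]
  · intro i _
    refine le_trans ?_ (le_gjsTerm h0 h1 measureReal_nonneg measureReal_nonneg)
    have := lowerConst_pos h0 h1
    positivity

lemma norm_sqrtVec_sub_sq [Fintype Ω] (P Q : ProbabilityMeasure Ω) :
    ‖sqrtVec P - sqrtVec Q‖ ^ 2 =
      ∑ i, (√((P : Measure Ω).real {i}) - √((Q : Measure Ω).real {i})) ^ 2 := by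
  simp [EuclideanSpace.norm_sq_eq, sqrtVec]

lemma sqrtVec_injective [Fintype Ω] [MeasurableSingletonClass Ω] : Function.Injective (sqrtVec (Ω := Ω)) := by
  intro P Q h
  refine Subtype.ext (show (P : Measure Ω) = (Q : Measure Ω) from
    Measure.ext_of_singleton fun i => ?_)
  have h1 : √((P : Measure Ω).real {i}) = √((Q : Measure Ω).real {i}) := by
    simpa [sqrtVec] using congrArg (fun v : EuclideanSpace ℝ Ω => v i) h
  rw [Real.sqrt_inj measureReal_nonneg measureReal_nonneg] at h1
  exact (ENNReal.toReal_eq_toReal_iff' (measure_ne_top _ _) (measure_ne_top _ _)).1 h1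

lemma norm_sqrtVec_sub_le_of_gjs_le [Fintype Ω] [MeasurableSingletonClass Ω]
    {lam R : ℝ} (h0 : 0 < lam) (h1 : lam < 1) (hR : 0 < R)
    {P Q : ProbabilityMeasure Ω} (h : gjs lam P Q ≤ ENNReal.ofReal R) :
    ‖sqrtVec P - sqrtVec Q‖ ≤ √(2 * R / lowerConst lam) := by
  have hL := lowerConst_pos h0 h1
  rw [gjs_eq_sum h0 h1, ENNReal.ofReal_le_ofReal_iff hR.le] at h
  refine Real.le_sqrt_of_sq_le ?_
  rw [le_div_iff₀ hL, norm_sqrtVec_sub_sq]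
  have := Finset.sum_le_sum fun (i : Ω) (_ : i ∈ Finset.univ) =>
    le_gjsTerm h0 h1 (measureReal_nonneg (μ := (P : Measure Ω)) (s := {i}))
      (measureReal_nonneg (μ := (Q : Measure Ω)) (s := {i}))
  rw [← Finset.mul_sum] at this
  linarith

lemma le_norm_sqrtVec_sub_of_lt_gjs [Fintype Ω] [MeasurableSingletonClass Ω]
    {lam R c : ℝ} (h0 : 0 < lam) (h1 : lam < 1) (hR : 0 < R) (hc : 0 < c)
    {P Q : ProbabilityMeasure Ω}
    (h : ENNReal.ofReal (c ^ 2 * (upperConst lam / lowerConst lam) * R) < gjs lam P Q) :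
    c * √(2 * R / lowerConst lam) ≤ ‖sqrtVec P - sqrtVec Q‖ := by
  have hL := lowerConst_pos h0 h1
  have hU := hL.trans_le (lowerConst_le_upperConst h0 h1)
  rw [gjs_eq_sum h0 h1, ENNReal.ofReal_lt_ofReal_iff_of_nonneg (by positivity)] at h
  refine (sq_le_sq₀ (by positivity) (norm_nonneg _)).1 ?_
  rw [mul_pow, Real.sq_sqrt (by positivity), norm_sqrtVec_sub_sq]
  have := Finset.sum_le_sum fun (i : Ω) (_ : i ∈ Finset.univ) =>
    gjsTerm_le h0 h1 (measureReal_nonneg (μ := (P : Measure Ω)) (s := {i}))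
      (measureReal_nonneg (μ := (Q : Measure Ω)) (s := {i}))
  rw [← Finset.mul_sum] at this
  have h2 := h.trans_le this
  have e : c ^ 2 * (upperConst lam / lowerConst lam) * R =
    upperConst lam / 2 * (c ^ 2 * (2 * R / lowerConst lam)) := by field_simp
  rw [e] at h2
  exact (lt_of_mul_lt_mul_left h2 (by positivity)).le

end Divergence

/-! ### Collision probabilities -/

lemma periodic_ceil_eq {r : ℝ} (hr : 0 < r) (x x' : ℝ) :
    Function.Periodic (fun b : ℝ => (⌈(x + b) / r⌉ = ⌈(x' + b) / r⌉)) r := by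
  intro b
  have (y : ℝ) : ⌈(y + (b + r)) / r⌉ = ⌈(y + b) / r⌉ + 1 := by
    rw [← add_assoc, add_div, div_self hr.ne', Int.ceil_add_one]
  simp only [this, add_left_inj]

lemma measurableSet_ceil_eq (r x x' : ℝ) :
    MeasurableSet {b : ℝ | ⌈(x + b) / r⌉ = ⌈(x' + b) / r⌉} :=
  measurableSet_eq_fun (by fun_prop) (by fun_prop)

lemma volume_real_inter_Ioc_of_periodic {A : Set ℝ} (hA : MeasurableSet A) {r : ℝ} (hr : 0 < r)
    (hper : Function.Periodic (fun b => b ∈ A) r) (s t : ℝ) :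
    volume.real (A ∩ Set.Ioc s (s + r)) = volume.real (A ∩ Set.Ioc t (t + r)) := by
  have hf : Function.Periodic (A.indicator (1 : ℝ → ℝ)) r := by
    intro b
    have := hper b
    rw [eq_iff_iff] at this
    by_cases h : b ∈ A
    · rw [Set.indicator_of_mem h, Set.indicator_of_mem (this.2 h)]; rfl
    · rw [Set.indicator_of_notMem h, Set.indicator_of_notMem fun h' => h (this.1 h')]
  have key : ∀ u : ℝ, ∫ x in u..u + r, A.indicator (1 : ℝ → ℝ) x =
      volume.real (A ∩ Set.Ioc u (u + r)) := by
    intro u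
    rw [intervalIntegral.integral_of_le (by linarith), integral_indicator_one hA,
      measureReal_restrict_apply hA]
  rw [← key, ← key, hf.intervalIntegral_add_eq s t]

lemma uniform_ceil_eq_of_le {r : ℝ} (hr : 0 < r) {x x' : ℝ} (hx : x ≤ x') :
    (cond volume (Set.Icc 0 r)).real {b : ℝ | ⌈(x + b) / r⌉ = ⌈(x' + b) / r⌉} =
      max 0 (1 - |x - x'| / r) := by
  set A := {b : ℝ | ⌈(x + b) / r⌉ = ⌈(x' + b) / r⌉} with hA
  have hAm : MeasurableSet A := measurableSet_ceil_eq r x x'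
  -- By periodicity in the shift, the window `[0, r]` may be replaced by `(-x, -x + r]`, on which
  -- the first point always lies in bucket `1`.
  have h1 : volume.real (A ∩ Set.Icc 0 r) = volume.real (A ∩ Set.Ioc (-x) (-x + r)) := by
    rw [← volume_real_inter_Ioc_of_periodic hAm hr (periodic_ceil_eq hr x x') 0 (-x), zero_add]
    exact measureReal_congr (Filter.EventuallyEq.rfl.inter Ioc_ae_eq_Icc.symm)
  have h2 : A ∩ Set.Ioc (-x) (-x + r) = Set.Ioc (-x) (-x + max 0 (r - (x' - x))) := by
    ext b
    simp only [Set.mem_inter_iff, Set.mem_Ioc, hA, Set.mem_ofPred_eq]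
    have hone : ∀ y : ℝ, ⌈y / r⌉ = 1 ↔ 0 < y ∧ y ≤ r := by
      intro y
      rw [Int.ceil_eq_iff]
      simp only [Int.cast_one, sub_self, div_pos_iff_of_pos_right hr, div_le_one hr]
    constructor
    · rintro ⟨h, hb1, hb2⟩
      have h3 : ⌈(x + b) / r⌉ = 1 := (hone _).2 ⟨by linarith, by linarith⟩
      rw [h3] at h
      have h4 := (hone _).1 h.symm
      exact ⟨hb1, by linarith [le_max_right 0 (r - (x' - x)), h4.2]⟩
    · rintro ⟨hb1, hb2⟩
      have h3 : b ≤ -x + (r - (x' - x)) := by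
        rcases le_total 0 (r - (x' - x)) with h | h
        · rwa [max_eq_right h] at hb2
        · rw [max_eq_left h] at hb2; linarith
      have h4 : ⌈(x + b) / r⌉ = 1 := (hone _).2 ⟨by linarith, by linarith⟩
      have h5 : ⌈(x' + b) / r⌉ = 1 := (hone _).2 ⟨by linarith, by linarith⟩
      exact ⟨by rw [h4, h5], hb1, by linarith⟩
  have habs : |x - x'| = x' - x := by rw [abs_sub_comm, abs_of_nonneg (by linarith)]
  rw [Measure.real, cond_apply measurableSet_Icc, ENNReal.toReal_mul, Set.inter_comm,
    ← Measure.real, h1, h2, Real.volume_real_Ioc_of_le (by linarith [le_max_left 0 (r - (x' - x))]),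
    Real.volume_Icc, ENNReal.toReal_inv, ENNReal.toReal_ofReal (by linarith), habs, sub_zero,
    add_sub_cancel_left, mul_max_of_nonneg _ _ (inv_nonneg.2 hr.le), mul_zero]
  congr 1
  field_simp

lemma uniform_ceil_eq {r : ℝ} (hr : 0 < r) (x x' : ℝ) :
    (cond volume (Set.Icc 0 r)).real {b : ℝ | ⌈(x + b) / r⌉ = ⌈(x' + b) / r⌉} =
      max 0 (1 - |x - x'| / r) := by
  rcases le_total x x' with h | h
  · exact uniform_ceil_eq_of_le hr h
  · have := uniform_ceil_eq_of_le hr h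
    simp only [eq_comm (a := ⌈(x + _) / r⌉)]
    rwa [abs_sub_comm]

/-- After `z = t / u` the density no longer involves `u`, which remains only in the linear factor
and the upper limit; monotonicity in `u` and scaling invariance can then be read off. -/
lemma collisionProb_eq_intervalIntegral {r u : ℝ} (hr : 0 < r) (hu : 0 < u) :
    collisionProb r u =
      ∫ z in (0 : ℝ)..r / u, 2 * gaussianPDFReal 0 1 z * (1 - u * z / r) := by
  have h := intervalIntegral.integral_comp_div (a := 0) (b := r)
    (fun z => absNormalPDF z * (1 - u * z / r)) hu.ne'
  rw [zero_div, smul_eq_mul] at h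
  have h2 : ∫ z in (0 : ℝ)..r / u, absNormalPDF z * (1 - u * z / r) =
      ∫ z in (0 : ℝ)..r / u, 2 * gaussianPDFReal 0 1 z * (1 - u * z / r) := by
    refine intervalIntegral.integral_congr fun z hz => ?_
    rw [Set.uIcc_of_le (by positivity)] at hz
    simp only [absNormalPDF, if_pos hz.1]
  rw [← h2, collisionProb, ← mul_right_inj' hu.ne', ← h, ← intervalIntegral.integral_const_mul]
  refine intervalIntegral.integral_congr fun t _ => ?_
  field_simp

lemma continuous_gaussianPDFReal_zero_one : Continuous (gaussianPDFReal 0 1) := by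
  unfold gaussianPDFReal
  fun_prop

lemma collisionProb_strictAnti {r u v : ℝ} (hr : 0 < r) (hu : 0 < u) (huv : u < v) :
    collisionProb r v < collisionProb r u := by
  have hv : 0 < v := hu.trans huv
  rw [collisionProb_eq_intervalIntegral hr hu, collisionProb_eq_intervalIntegral hr hv]
  have hcont : ∀ w : ℝ, Continuous fun z => 2 * gaussianPDFReal 0 1 z * (1 - w * z / r) := by
    intro w
    have := continuous_gaussianPDFReal_zero_one
    fun_prop
  have hle : r / v ≤ r / u := div_le_div_of_nonneg_left hr.le hu huv.le
  rw [← intervalIntegral.integral_add_adjacent_intervals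
    ((hcont u).intervalIntegrable 0 (r / v)) ((hcont u).intervalIntegrable (r / v) (r / u))]
  have h1 : ∫ z in (0 : ℝ)..r / v, 2 * gaussianPDFReal 0 1 z * (1 - v * z / r) <
      ∫ z in (0 : ℝ)..r / v, 2 * gaussianPDFReal 0 1 z * (1 - u * z / r) := by
    have hrv : 0 < r / v := by positivity
    refine intervalIntegral.integral_lt_integral_of_continuousOn_of_le_of_exists_lt hrv
      (hcont v).continuousOn (hcont u).continuousOn (fun z hz => ?_) ⟨r / v, ⟨hrv.le, le_rfl⟩, ?_⟩
    · have := gaussianPDFReal_nonneg 0 1 z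
      have := hz.1
      gcongr
    · have := gaussianPDFReal_pos 0 1 (r / v) one_ne_zero
      gcongr
  have h2 : 0 ≤ ∫ z in r / v..r / u, 2 * gaussianPDFReal 0 1 z * (1 - u * z / r) := by
    refine intervalIntegral.integral_nonneg hle fun z hz => ?_
    refine mul_nonneg (mul_nonneg two_pos.le (gaussianPDFReal_nonneg _ _ _)) (sub_nonneg.2 ?_)
    rw [div_le_one hr, mul_comm]
    exact (le_div_iff₀ hu).1 hz.2
  linarith

lemma collisionProb_antitoneOn {r u v : ℝ} (hr : 0 < r) (hu : 0 < u) (huv : u ≤ v) :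
    collisionProb r v ≤ collisionProb r u := by
  rcases huv.eq_or_lt with rfl | h
  · rfl
  · exact (collisionProb_strictAnti hr hu h).le

lemma collisionProb_mul_mul {r u s : ℝ} (hr : 0 < r) (hu : 0 < u) (hs : 0 < s) :
    collisionProb (r * s) (u * s) = collisionProb r u := by
  rw [collisionProb_eq_intervalIntegral hr hu,
    collisionProb_eq_intervalIntegral (mul_pos hr hs) (mul_pos hu hs),
    mul_div_mul_right _ _ hs.ne']
  refine intervalIntegral.integral_congr fun t _ => ?_
  change 2 * gaussianPDFReal 0 1 t * (1 - u * s * t / (r * s)) = _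
  rw [mul_right_comm u s t, mul_div_mul_right _ _ hs.ne']

lemma collisionProb_eq_integral_gaussianReal {r u : ℝ} (hr : 0 < r) (hu : 0 < u) :
    collisionProb r u = ∫ z, max 0 (1 - |u * z| / r) ∂gaussianReal 0 1 := by
  rw [integral_gaussianReal_eq_integral_smul one_ne_zero]
  -- The integrand is even, so the integral over the line is twice that over the half-line; the tent
  -- vanishes past `r / u`.
  have h := integral_comp_abs (f := fun z => gaussianPDFReal 0 1 z * max 0 (1 - u * z / r))
  have e : ∀ z : ℝ, gaussianPDFReal 0 1 |z| * max 0 (1 - u * |z| / r) =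
      gaussianPDFReal 0 1 z • max 0 (1 - |u * z| / r) := by
    intro z
    rw [abs_mul, abs_of_pos hu]
    simp [gaussianPDFReal]
  simp only [e] at h
  have hru : 0 < r / u := by positivity
  rw [h, collisionProb_eq_intervalIntegral hr hu, intervalIntegral.integral_of_le hru.le,
    ← integral_const_mul]
  have hvan : ∀ z ∈ Set.Ioi (0 : ℝ) \ Set.Ioc 0 (r / u),
      2 * (gaussianPDFReal 0 1 z * max 0 (1 - u * z / r)) = 0 := by
    rintro z ⟨hz0, hz⟩
    have hz1 : r / u < z := by
      by_contra! hle
      exact hz ⟨hz0, hle⟩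
    rw [div_lt_iff₀ hu] at hz1
    have : 1 - u * z / r ≤ 0 := by
      rw [sub_nonpos, one_le_div hr]; linarith
    rw [max_eq_left this]; ring
  rw [setIntegral_eq_of_subset_of_forall_sdiff_eq_zero measurableSet_Ioi
    (fun z hz => hz.1) hvan]
  refine setIntegral_congr_fun measurableSet_Ioc fun z hz => ?_
  have : 0 ≤ 1 - u * z / r := by
    rw [sub_nonneg, div_le_one hr, mul_comm]
    exact (le_div_iff₀ hu).1 hz.2
  simp only [max_eq_right this]
  ring

lemma collisionProb_le_one {r u : ℝ} (hr : 0 < r) (hu : 0 < u) : collisionProb r u ≤ 1 := by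
  rw [collisionProb_eq_integral_gaussianReal hr hu]
  have hb : ∀ z : ℝ, max 0 (1 - |u * z| / r) ≤ 1 := fun z =>
    max_le zero_le_one (sub_le_self _ (by positivity))
  calc _ ≤ ∫ _, (1 : ℝ) ∂gaussianReal 0 1 := by
        refine integral_mono (Integrable.of_bound (C := 1) (by fun_prop)
          (Filter.Eventually.of_forall fun z => ?_)) (integrable_const _) hb
        rw [Real.norm_of_nonneg (le_max_left _ _)]
        exact hb z
    _ = 1 := by simp

lemma stdGaussian_map_inner {E : Type*} [NormedAddCommGroup E] [InnerProductSpace ℝ E]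
    [FiniteDimensional ℝ E] [MeasurableSpace E] [BorelSpace E] (v : E) :
    (stdGaussian E).map (fun a => inner ℝ a v) =
      (gaussianReal 0 1).map (fun z => ‖v‖ * z) := by
  have h := IsGaussian.map_eq_gaussianReal (μ := stdGaussian E) (innerSL ℝ v)
  rw [integral_strongDual_stdGaussian, variance_dual_stdGaussian, innerSL_apply_norm] at h
  rw [gaussianReal_map_const_mul]
  have e : (fun a : E => inner ℝ a v) = innerSL ℝ v := by
    ext a; rw [innerSL_apply_apply, real_inner_comm]
  rw [e, h, mul_zero, mul_one]
  congr 1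
  ext
  simp

/-! ### Collisions and sensitivity of the hash family -/

section Hash

variable {Ω : Type*} [Fintype Ω] [MeasurableSpace Ω]

lemma isProbabilityMeasure_uniform {r : ℝ} (hr : 0 < r) :
    IsProbabilityMeasure (cond volume (Set.Icc 0 r)) :=
  cond_isProbabilityMeasure_of_finite (by simpa using hr) (by simp)

lemma isProbabilityMeasure_hashLaw (Ω : Type*) [Fintype Ω] {r : ℝ} (hr : 0 < r) :
    IsProbabilityMeasure (hashLaw Ω r) := by
  have := isProbabilityMeasure_uniform hr
  unfold hashLaw
  infer_instance

lemma measurableSet_hash_eq (r : ℝ) (P Q : ProbabilityMeasure Ω) :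
    MeasurableSet {θ : EuclideanSpace ℝ Ω × ℝ | hash r θ P = hash r θ Q} := by
  unfold hash
  exact measurableSet_eq_fun (by fun_prop) (by fun_prop)

lemma hashLaw_real_collision {r : ℝ} (hr : 0 < r) (P Q : ProbabilityMeasure Ω)
    (hPQ : 0 < ‖sqrtVec P - sqrtVec Q‖) :
    (hashLaw Ω r).real {θ | hash r θ P = hash r θ Q} =
      collisionProb r ‖sqrtVec P - sqrtVec Q‖ := by
  have := isProbabilityMeasure_uniform hr
  have hS := measurableSet_hash_eq r P Q
  have htent : Continuous fun z : ℝ => max 0 (1 - |z| / r) := by fun_prop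
  calc (hashLaw Ω r).real {θ | hash r θ P = hash r θ Q}
      = ∫ a, (cond volume (Set.Icc 0 r)).real
          {b : ℝ | ⌈(inner ℝ a (sqrtVec P) + b) / r⌉ = ⌈(inner ℝ a (sqrtVec Q) + b) / r⌉}
          ∂stdGaussian (EuclideanSpace ℝ Ω) := by
        rw [hashLaw, Measure.real, Measure.prod_apply hS, ← integral_toReal
          (measurable_measure_prodMk_left hS).aemeasurable
          (Filter.Eventually.of_forall fun a => measure_lt_top _ _)]
        rfl
    _ = ∫ a, max 0 (1 - |inner ℝ a (sqrtVec P - sqrtVec Q)| / r)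
          ∂stdGaussian (EuclideanSpace ℝ Ω) := by
        simp only [uniform_ceil_eq hr, inner_sub_right]
    _ = ∫ z, max 0 (1 - |z| / r)
          ∂(stdGaussian (EuclideanSpace ℝ Ω)).map (fun a => inner ℝ a (sqrtVec P - sqrtVec Q)) := by
        rw [integral_map (by fun_prop) htent.aestronglyMeasurable]
    _ = collisionProb r ‖sqrtVec P - sqrtVec Q‖ := by
        rw [stdGaussian_map_inner, integral_map (by fun_prop) htent.aestronglyMeasurable,
          collisionProb_eq_integral_gaussianReal hr hPQ]

lemma isSensitive_hash [MeasurableSingletonClass Ω] {lam r R c R₁ : ℝ} (h0 : 0 < lam)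
    (h1 : lam < 1) (hr : 0 < r) (hR : 0 < R) (hc : 1 < c)
    (hR₁ : R₁ = √(2 * R / lowerConst lam)) :
    IsSensitive (hashLaw Ω r) (hash r) (gjs (Ω := Ω) lam) R
      (c ^ 2 * (upperConst lam / lowerConst lam) * R) (collisionProb r R₁)
      (collisionProb r (c * R₁)) := by
  have hL := lowerConst_pos h0 h1
  have hR₁0 : 0 < R₁ := by rw [hR₁]; positivity
  have hcR : R₁ < c * R₁ := by nlinarith
  have hprob := isProbabilityMeasure_hashLaw Ω hr
  refine ⟨hprob, ?_, collisionProb_strictAnti hr hR₁0 hcR,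
    fun P Q => ⟨measurableSet_hash_eq r P Q, fun h => ?_, fun h => ?_⟩⟩
  · have hUL : 1 ≤ upperConst lam / lowerConst lam :=
      (one_le_div hL).2 (lowerConst_le_upperConst h0 h1)
    have hc2 : 1 < c ^ 2 := one_lt_pow₀ hc two_ne_zero
    have : 1 < c ^ 2 * (upperConst lam / lowerConst lam) := by nlinarith
    nlinarith
  · have hle := norm_sqrtVec_sub_le_of_gjs_le h0 h1 hR h
    rw [← hR₁] at hle
    -- Distance zero is separate: `collisionProb r 0` is `0` because `1 / 0 = 0`, whereas equal
    -- distributions collide surely.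
    rcases (norm_nonneg (sqrtVec P - sqrtVec Q)).eq_or_lt with hz | hz
    · have hPQ : P = Q := sqrtVec_injective (sub_eq_zero.1 (norm_eq_zero.1 hz.symm))
      subst hPQ
      simpa using collisionProb_le_one hr hR₁0
    · rw [hashLaw_real_collision hr P Q hz]
      exact collisionProb_antitoneOn hr hz hle
  · have hle := le_norm_sqrtVec_sub_of_lt_gjs h0 h1 hR (by linarith) h
    rw [← hR₁] at hle
    have hcR0 : 0 < c * R₁ := hR₁0.trans hcR
    rw [hashLaw_real_collision hr P Q (hcR0.trans_le hle)]
    exact collisionProb_antitoneOn hr hcR0 hle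

end Hash

end GJSHash

theorem mainTheorem6 {Ω : Type*} [Fintype Ω] [MeasurableSpace Ω] [MeasurableSingletonClass Ω]
    (lam : ℝ) (hlam0 : 0 < lam) (hlam1 : lam < 1) (r : ℝ) (hr : 0 < r) :
    -- collision probability of two distributions at distance `‖√P - √Q‖₂`
    (∀ P Q : ProbabilityMeasure Ω, P ≠ Q →
      (GJSHash.hashLaw Ω r).real {θ | GJSHash.hash r θ P = GJSHash.hash r θ Q} =
        GJSHash.collisionProb r ‖GJSHash.sqrtVec P - GJSHash.sqrtVec Q‖) ∧
    ∀ R c R₁ : ℝ, 0 < R → 1 < c → R₁ = √(2 * R / GJSHash.lowerConst lam) →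
      -- bucket width `r`
      GJSHash.IsSensitive (GJSHash.hashLaw Ω r) (GJSHash.hash r)
        (GJSHash.gjs (Ω := Ω) lam)
        R (c ^ 2 * (GJSHash.upperConst lam / GJSHash.lowerConst lam) * R)
        (GJSHash.collisionProb r R₁) (GJSHash.collisionProb r (c * R₁)) ∧
      -- bucket width `r` in units of `R₁`
      GJSHash.IsSensitive (GJSHash.hashLaw Ω (r * R₁)) (GJSHash.hash (r * R₁))
        (GJSHash.gjs (Ω := Ω) lam)
        R (c ^ 2 * (GJSHash.upperConst lam / GJSHash.lowerConst lam) * R)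
        (GJSHash.collisionProb r 1) (GJSHash.collisionProb r c) := by
  refine ⟨fun P Q hPQ => GJSHash.hashLaw_real_collision hr P Q (norm_pos_iff.2
    (sub_ne_zero.2 fun h => hPQ (GJSHash.sqrtVec_injective h))), fun R c R₁ hR hc hR₁ =>
    ⟨GJSHash.isSensitive_hash hlam0 hlam1 hr hR hc hR₁, ?_⟩⟩
  have hL := GJSHash.lowerConst_pos hlam0 hlam1
  have hR₁0 : 0 < R₁ := by rw [hR₁]; positivity
  -- The second family is the first with bucket width `r * R₁`; the common factor `R₁` then cancels
  -- in `collisionProb`.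
  have h := GJSHash.isSensitive_hash (Ω := Ω) hlam0 hlam1 (mul_pos hr hR₁0) hR hc hR₁
  rw [GJSHash.collisionProb_mul_mul hr (zero_lt_one.trans hc) hR₁0] at h
  have h1 := GJSHash.collisionProb_mul_mul hr one_pos hR₁0
  rw [one_mul] at h1
  rwa [h1] at h
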